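/- **Setting.** Let $N\ge 1$, let $V=\{1,\dots,N\}$, and let $G_R=(V,E_R)$ and $G_T=(V,E_T)$ be strongly connected directed graphs. Let $\delta_i^R>0$ and $\delta_i^T>0$ for $1\le i\le N$, and let $f_i^U,f_i^T,g_i^U,g_i^R:[0,1]^N\to\mathbb R$ ($1\le i\le N$) be twice continuously differentiable functions (one-sided derivatives being used on the boundary of $[0,1]^N$) such that, for all $i,j,k$: 1. $f_i^U$ depends on its argument $x_j$ if and only if $(i,j)\in E_R$, and so does $f_i^T$; $g_i^U$ depends on $x_j$ if and only if $(i,j)\in E_T$, and so does $g_i^R$; 2. $f_i^U(0)=f_i^T(0)=g_i^U(0)=g_i^R(0)=0$; 3. $f_i^U\ge f_i^T$ and $g_i^U\ge g_i^R$ on $[0,1]^N$; 4. for each $h\in\{f_i^U,f_i^T,g_i^U,g_i^R\}$, $\frac{\partial h}{\partial x_j}>0$ on $[0,1]^N$ if $h$ depends on $x_j$, and $\frac{\partial^2 h}{\partial x_j\partial x_k}\le 0$ on $[0,1]^N$. The generic URTU model is the system, for $1\le i\le N$, with $\mathbf R=(R_1,\dots,R_N)$ and $\mathbf T=(T_1,\dots,T_N)$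 in $[0,1]^N$, $$\frac{dR_i}{dt}=(1-R_i-T_i)f_i^U(\mathbf R)-\delta_i^RR_i+T_if_i^T(\mathbf R)-R_ig_i^R(\mathbf T),$$ $$\frac{dT_i}{dt}=(1-R_i-T_i)g_i^U(\mathbf T)-\delta_i^TT_i+R_ig_i^R(\mathbf T)-T_if_i^T(\mathbf R).$$ Let $\Omega=\{(\mathbf R,\mathbf T): R_i\ge 0,\ T_i\ge 0,\ R_i+T_i\le 1 \text{ for } 1\le i\le N\}$, let $\mathbf Q_1=\Big(\frac{\partial f_i^U}{\partial x_j}(0)\Big)_{i,j}-\mathrm{diag}(\delta_i^R)$ and $\mathbf Q_2=\Big(\frac{\partial g_i^U}{\partial x_j}(0)\Big)_{i,j}-\mathrm{diag}(\delta_i^T)$, and for a real square matrix $\mathbf A$ let $s(\mathbf A)$ be the maximum real part of an eigenvalue of $\mathbf A$. **Theorem.** If $s(\mathbf Q_1)\le 0$ and $s(\mathbf Q_2)\le 0$, then the uncertain equilibrium $\mathbf E_U=\mathbf 0$ attracts the positively invariant region $\Omega$: $\mathbf 0$ is an equilibrium of the model; from every point of $\Omega$ starts a solution on $[0,\infty)$;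 and every solution on $[0,\infty)$ that starts in $\Omega$ remains in $\Omega$ and satisfies $(\mathbf R(t),\mathbf T(t))\to\mathbf 0$ as $t\to\infty$. Hence the fractions $R(t)=\frac1N\sum_{i=1}^NR_i(t)$ and $T(t)=\frac1N\sum_{i=1}^NT_i(t)$ of rumor-believers and truth-believers both tend to $0$ as $t\to\infty$. -/

import Mathlib

open Set Filter Topology

noncomputable section

namespace URTU

/-- The cube `[0,1]^N`: the arguments of the spreading rates are vectors of probabilities. -/
def cube (N : ℕ) : Set (Fin N → ℝ) := Icc 0 1

/-- The partial derivative `∂f/∂x_j` of a function on the cube (one-sided on its boundary). -/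
def partialDeriv {N : ℕ} (j : Fin N) (f : (Fin N → ℝ) → ℝ) (x : Fin N → ℝ) : ℝ :=
  fderivWithin ℝ f (cube N) x (Pi.single j 1)

/-- `f`, as a function on the cube, is dependent upon its `j`-th argument. -/
def DependsOnArg {N : ℕ} (f : (Fin N → ℝ) → ℝ) (j : Fin N) : Prop :=
  ∃ x ∈ cube N, ∃ y ∈ cube N, (∀ k, k ≠ j → x k = y k) ∧ f x ≠ f y

/-- A digraph is strongly connected: any two vertices are joined by directed paths. -/
def StronglyConnected {V : Type*} (G : Digraph V) : Prop :=
  ∀ i j, Relation.ReflTransGen G.Adj i j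

/-- The conditions on one family of spreading rates `f_1, …, f_N : [0,1]^N → ℝ` along a network
`G`, where `G.Adj i j` means that person `j` can pass the message to person `i`. -/
structure IsSpreadingRate {N : ℕ} (G : Digraph (Fin N)) (f : Fin N → (Fin N → ℝ) → ℝ) :
    Prop where
  proximity : ∀ i j, DependsOnArg (f i) j ↔ G.Adj i j
  nullity : ∀ i, f i 0 = 0
  smooth : ∀ i, ContDiffOn ℝ 2 (f i) (cube N)
  monotone : ∀ i j, DependsOnArg (f i) j → ∀ x ∈ cube N, 0 < partialDeriv j (f i) x
  concave : ∀ i j k, ∀ x ∈ cube N, partialDeriv k (partialDeriv j (f i)) x ≤ 0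

/-- The data of a generic URTU model with `N` persons, with its standing assumptions. -/
structure Model (N : ℕ) where
  /-- the rumor-spreading network -/
  GR : Digraph (Fin N)
  /-- the truth-spreading network -/
  GT : Digraph (Fin N)
  /-- the rumor-spreading rates on uncertain persons -/
  fU : Fin N → (Fin N → ℝ) → ℝ
  /-- the rumor-spreading rates on truth-believers -/
  fT : Fin N → (Fin N → ℝ) → ℝ
  /-- the truth-spreading rates on uncertain persons -/
  gU : Fin N → (Fin N → ℝ) → ℝ
  /-- the truth-spreading rates on rumor-believers -/
  gR : Fin N → (Fin N → ℝ) → ℝ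
  /-- the rates at which rumor-believers become uncertain -/
  δR : Fin N → ℝ
  /-- the rates at which truth-believers become uncertain -/
  δT : Fin N → ℝ
  connR : StronglyConnected GR
  connT : StronglyConnected GT
  rate_fU : IsSpreadingRate GR fU
  rate_fT : IsSpreadingRate GR fT
  rate_gU : IsSpreadingRate GT gU
  rate_gR : IsSpreadingRate GT gR
  ordering_f : ∀ i, ∀ x ∈ cube N, fT i x ≤ fU i x
  ordering_g : ∀ i, ∀ x ∈ cube N, gR i x ≤ gU i x
  δR_pos : ∀ i, 0 < δR i
  δT_pos : ∀ i, 0 < δT i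

/-- States `(R, T)` of the model. -/
abbrev State (N : ℕ) : Type := (Fin N → ℝ) × (Fin N → ℝ)

/-- The right-hand side of the generic URTU model. -/
def Model.field {N : ℕ} (M : Model N) (x : State N) : State N :=
  (fun i => (1 - x.1 i - x.2 i) * M.fU i x.1 - M.δR i * x.1 i
      + x.2 i * M.fT i x.1 - x.1 i * M.gR i x.2,
   fun i => (1 - x.1 i - x.2 i) * M.gU i x.2 - M.δT i * x.2 i
      + x.1 i * M.gR i x.2 - x.2 i * M.fT i x.1)

/-- A solution on `[0, ∞)` of the model. Its values `R(t)` and `T(t)` lie in `[0,1]^N`, where the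
spreading rates are given. -/
structure Model.IsSolution {N : ℕ} (M : Model N) (γ : ℝ → State N) : Prop where
  mem_domain : ∀ t, 0 ≤ t → (γ t).1 ∈ cube N ∧ (γ t).2 ∈ cube N
  ode : IsIntegralCurveOn γ (fun _ => M.field) (Ici 0)

/-- The region `Ω`. -/
def Ω (N : ℕ) : Set (State N) :=
  {x | ∀ i, 0 ≤ x.1 i ∧ 0 ≤ x.2 i ∧ x.1 i + x.2 i ≤ 1}

def Model.IsEquilibrium {N : ℕ} (M : Model N) (e : State N) : Prop := M.field e = 0

def Model.PositivelyInvariant {N : ℕ} (M : Model N) (S : Set (State N)) : Prop :=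
  ∀ γ, M.IsSolution γ → γ 0 ∈ S → ∀ t, 0 ≤ t → γ t ∈ S

/-- The point `e` attracts `S`: from each point of `S` starts a solution on `[0, ∞)`, and the
solutions that start in `S` tend to `e`. -/
def Model.Attracts {N : ℕ} (M : Model N) (e : State N) (S : Set (State N)) : Prop :=
  (∀ x ∈ S, ∃ γ, M.IsSolution γ ∧ γ 0 = x) ∧
    ∀ γ, M.IsSolution γ → γ 0 ∈ S → Tendsto γ atTop (𝓝 e)

/-- The maximum real part `s(A)` of a (complex) eigenvalue of a real square matrix. -/
def maxRe {N : ℕ} (A : Matrix (Fin N) (Fin N) ℝ) : ℝ :=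
  sSup (Complex.re ''
    {μ : ℂ | Module.End.HasEigenvalue (Matrix.toLin' (A.map Complex.ofReal)) μ})

/-- The Jacobian matrix at the origin. -/
def jacobian {N : ℕ} (f : Fin N → (Fin N → ℝ) → ℝ) : Matrix (Fin N) (Fin N) ℝ :=
  Matrix.of fun i j => partialDeriv j (f i) 0

def Model.Q₁ {N : ℕ} (M : Model N) : Matrix (Fin N) (Fin N) ℝ :=
  jacobian M.fU - Matrix.diagonal M.δR

def Model.Q₂ {N : ℕ} (M : Model N) : Matrix (Fin N) (Fin N) ℝ :=
  jacobian M.gU - Matrix.diagonal M.δT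

/-- The fraction of believers, given the probabilities `p i` that person `i` is a believer. -/
def fraction {N : ℕ} (p : Fin N → ℝ) : ℝ := 1 / (N : ℝ) * ∑ i, p i

end URTU

end

namespace URTU

variable {N : ℕ}

/-! The two messages decouple. Because `fT ≤ fU` and `gR ≥ 0`, each R_i satisfies the one-message
inequality R_i' ≤ (1 - R_i) f_i^U(R) - δ_i R_i, and symmetrically for T (`Model.tendsto_zero`).
Concavity puts a rate below its linearization J at the origin (`le_jacobian_mulVec`), and
Perron–Frobenius turns s(J - diag δ) ≤ 0 into a vector v > 0 with Jv ≤ δv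
(`exists_pos_subsolution`). In the critical case s = 0 the linear part alone gives no decay. The
factor 1 - R_i supplies a quadratic loss, so φ(t)v with φ' = -cφ² is a strict barrier, and the
probabilities are O(1/t) (`IsSpreadingRate.tendsto_zero`). Solutions exist because the field,
Lipschitz on the compact cube, extends to a bounded Lipschitz field whose curves cannot leave the
cube (`Model.exists_isSolution`). -/

theorem mem_cube_iff {x : Fin N → ℝ} : x ∈ cube N ↔ ∀ i, x i ∈ Icc (0 : ℝ) 1 := by
  simp only [cube, mem_Icc, Pi.le_def, Pi.zero_apply, Pi.one_apply]
  exact forall_and.symm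

theorem zero_mem_cube : (0 : Fin N → ℝ) ∈ cube N := by simp [mem_cube_iff]

theorem convex_cube : Convex ℝ (cube N) := convex_Icc 0 1

theorem isCompact_cube : IsCompact (cube N) := isCompact_Icc

theorem uniqueDiffOn_cube : UniqueDiffOn ℝ (cube N) := by
  have : cube N = univ.pi fun _ => Icc (0 : ℝ) 1 := by
    ext x
    simp only [mem_cube_iff, mem_univ_pi]
  rw [this]
  exact UniqueDiffOn.univ_pi fun _ => uniqueDiffOn_Icc zero_lt_one

theorem smul_mem_cube {x : Fin N → ℝ} (hx : x ∈ cube N) {t : ℝ} (ht : t ∈ Icc (0 : ℝ) 1) :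
    t • x ∈ cube N := by
  rw [mem_cube_iff] at hx ⊢
  intro i
  exact ⟨mul_nonneg ht.1 (hx i).1, mul_le_one₀ ht.2 (hx i).1 (hx i).2⟩

theorem fderivWithin_cube_apply (f : (Fin N → ℝ) → ℝ) (x y : Fin N → ℝ) :
    fderivWithin ℝ f (cube N) x y = ∑ j, y j * partialDeriv j f x := by
  have h := (fderivWithin ℝ f (cube N) x).toLinearMap.pi_apply_eq_sum_univ y
  simp only [ContinuousLinearMap.coe_coe, smul_eq_mul] at h
  rw [h]
  refine Finset.sum_congr rfl fun j _ => ?_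
  rw [partialDeriv]
  congr 2
  ext k
  simp [Pi.single_apply, eq_comm]

theorem hasDerivWithinAt_ray {f : (Fin N → ℝ) → ℝ} (hf : DifferentiableOn ℝ f (cube N))
    {x : Fin N → ℝ} (hx : x ∈ cube N) {t : ℝ} (ht : t ∈ Icc (0 : ℝ) 1) :
    HasDerivWithinAt (fun s : ℝ => f (s • x)) (∑ j, x j * partialDeriv j f (t • x))
      (Icc 0 1) t := by
  rw [← fderivWithin_cube_apply]
  have h1 : HasDerivWithinAt (fun s : ℝ => s • x) x (Icc 0 1) t := by
    simpa using ((hasDerivAt_id t).smul_const x).hasDerivWithinAt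
  exact (hf _ (smul_mem_cube hx ht)).hasFDerivWithinAt.comp_hasDerivWithinAt t h1
    fun s hs => smul_mem_cube hx hs

/-- With the other coordinates frozen, `f` is constant on [0,1], and one-sided derivatives there are
unique. This covers the pairs about which `monotone` is silent. -/
theorem partialDeriv_eq_zero {f : (Fin N → ℝ) → ℝ} (hf : DifferentiableOn ℝ f (cube N))
    {j : Fin N} (hj : ¬ DependsOnArg f j) {x : Fin N → ℝ} (hx : x ∈ cube N) :
    partialDeriv j f x = 0 := by
  have hx' := mem_cube_iff.1 hx
  have hmaps : MapsTo (Function.update x j) (Icc 0 1) (cube N) := by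
    intro s hs
    rw [mem_cube_iff]
    intro k
    by_cases hk : k = j
    · subst hk; simpa using hs
    · simpa [hk] using hx' k
  have hd : HasDerivWithinAt (f ∘ Function.update x j) (partialDeriv j f x) (Icc 0 1) (x j) := by
    have h2 := (hf x hx).hasFDerivWithinAt
    rw [← Function.update_eq_self j x] at h2
    have := h2.comp_hasDerivWithinAt (x j) (hasDerivAt_update x j (x j)).hasDerivWithinAt hmaps
    simpa [partialDeriv] using this
  have hc : HasDerivWithinAt (f ∘ Function.update x j) 0 (Icc 0 1) (x j) := by
    refine (hasDerivWithinAt_const (x j) (Icc 0 1) (f x)).congr_of_mem (fun s hs => ?_) (hx' j)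
    by_contra hne
    exact hj ⟨_, hmaps hs, x, hx, fun k hk => by simp [hk], hne⟩
  exact (uniqueDiffOn_Icc zero_lt_one _ (hx' j)).eq_deriv _ hd hc

theorem differentiableOn_partialDeriv {f : (Fin N → ℝ) → ℝ} (hf : ContDiffOn ℝ 2 f (cube N))
    (j : Fin N) : DifferentiableOn ℝ (partialDeriv j f) (cube N) := by
  have h := (hf.fderivWithin uniqueDiffOn_cube (m := 1) (by norm_num)).differentiableOn
    one_ne_zero
  exact h.clm_apply (differentiableOn_const _)

/-! ### Spreading rates along rays from the origin -/

namespace IsSpreadingRate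

variable {G : Digraph (Fin N)} {f : Fin N → (Fin N → ℝ) → ℝ}

theorem differentiableOn (h : IsSpreadingRate G f) (i : Fin N) :
    DifferentiableOn ℝ (f i) (cube N) := (h.smooth i).differentiableOn two_ne_zero

theorem partialDeriv_nonneg (h : IsSpreadingRate G f) (i j : Fin N) {x : Fin N → ℝ}
    (hx : x ∈ cube N) : 0 ≤ partialDeriv j (f i) x := by
  by_cases hj : DependsOnArg (f i) j
  · exact (h.monotone i j hj x hx).le
  · exact (partialDeriv_eq_zero (h.differentiableOn i) hj hx).ge

theorem jacobian_nonneg (h : IsSpreadingRate G f) (i j : Fin N) : 0 ≤ jacobian f i j :=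
  h.partialDeriv_nonneg i j zero_mem_cube

theorem jacobian_pos (h : IsSpreadingRate G f) {i j : Fin N} (hij : G.Adj i j) :
    0 < jacobian f i j :=
  h.monotone i j ((h.proximity i j).2 hij) 0 zero_mem_cube

/-- The rate vanishes at 0 and is nondecreasing along the ray to `x`. -/
theorem nonneg (h : IsSpreadingRate G f) (i : Fin N) {x : Fin N → ℝ} (hx : x ∈ cube N) :
    0 ≤ f i x := by
  have hd := fun t ht => hasDerivWithinAt_ray (h.differentiableOn i) hx (t := t) ht
  have hm : MonotoneOn (fun s : ℝ => f i (s • x)) (Icc 0 1) :=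
    monotoneOn_of_hasDerivWithinAt_nonneg (convex_Icc 0 1)
      (fun t ht => (hd t ht).continuousWithinAt)
      (fun t ht => (hd t (interior_subset ht)).mono interior_subset)
      (fun t ht => Finset.sum_nonneg fun j _ => mul_nonneg ((mem_cube_iff.1 hx j).1)
        (h.partialDeriv_nonneg i j (smul_mem_cube hx (interior_subset ht))))
  simpa [h.nullity i] using hm (left_mem_Icc.2 zero_le_one) (right_mem_Icc.2 zero_le_one)
    zero_le_one

/-- The partial derivatives decrease along rays from the origin. -/
theorem partialDeriv_ray_le (h : IsSpreadingRate G f) (i j : Fin N) {x : Fin N → ℝ}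
    (hx : x ∈ cube N) {t : ℝ} (ht : t ∈ Icc (0 : ℝ) 1) :
    partialDeriv j (f i) (t • x) ≤ jacobian f i j := by
  have hd := fun t ht =>
    hasDerivWithinAt_ray (differentiableOn_partialDeriv (h.smooth i) j) hx (t := t) ht
  have hm : AntitoneOn (fun s : ℝ => partialDeriv j (f i) (s • x)) (Icc 0 1) :=
    antitoneOn_of_hasDerivWithinAt_nonpos (convex_Icc 0 1)
      (fun t ht => (hd t ht).continuousWithinAt)
      (fun t ht => (hd t (interior_subset ht)).mono interior_subset)
      (fun t ht => Finset.sum_nonpos fun k _ => mul_nonpos_of_nonneg_of_nonpos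
        ((mem_cube_iff.1 hx k).1) (h.concave i j k _ (smul_mem_cube hx (interior_subset ht))))
  simpa [jacobian] using hm (left_mem_Icc.2 zero_le_one) ht ht.1

/-- A spreading rate lies below its linearization at the origin. -/
theorem le_jacobian_mulVec (h : IsSpreadingRate G f) (i : Fin N) {x : Fin N → ℝ}
    (hx : x ∈ cube N) : f i x ≤ ∑ j, jacobian f i j * x j := by
  set c := ∑ j, jacobian f i j * x j with hc
  have hd := fun t ht => (hasDerivWithinAt_ray (h.differentiableOn i) hx (t := t) ht).sub
    ((hasDerivAt_id t).mul_const c).hasDerivWithinAt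
  have hm := antitoneOn_of_hasDerivWithinAt_nonpos (convex_Icc (0 : ℝ) 1)
      (fun t ht => (hd t ht).continuousWithinAt)
      (fun t ht => (hd t (interior_subset ht)).mono interior_subset)
      (fun t ht => by
        rw [one_mul, hc, sub_nonpos]
        refine Finset.sum_le_sum fun j _ => ?_
        rw [mul_comm]
        exact mul_le_mul_of_nonneg_right (h.partialDeriv_ray_le i j hx (interior_subset ht))
          (mem_cube_iff.1 hx j).1)
  simpa [h.nullity i] using hm (left_mem_Icc.2 zero_le_one) (right_mem_Icc.2 zero_le_one)
    zero_le_one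

end IsSpreadingRate

/-! ### Perron–Frobenius and the spectral condition -/

/-- A nonnegative matrix whose positive entries connect all indices has a polynomial with
positive entries. -/
theorem exists_sum_pow_pos {B : Matrix (Fin N) (Fin N) ℝ} (hB : ∀ i j, 0 ≤ B i j)
    {G : Digraph (Fin N)} (hG : StronglyConnected G) (hadj : ∀ i j, G.Adj i j → 0 < B i j) :
    ∃ K, ∀ i j, 0 < (∑ k ∈ Finset.range K, B ^ k) i j := by
  have hpow : ∀ k i j, 0 ≤ (B ^ k) i j := by
    intro k
    induction k with
    | zero => intro i j; rw [pow_zero, Matrix.one_apply]; split_ifs <;> norm_num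
    | succ k ih =>
      intro i j
      rw [pow_succ, Matrix.mul_apply]
      exact Finset.sum_nonneg fun l _ => mul_nonneg (ih i l) (hB l j)
  have hex : ∀ i j, ∃ k, 0 < (B ^ k) i j := by
    intro i j
    induction hG i j with
    | refl => exact ⟨0, by simp⟩
    | tail _ hbc ih =>
      obtain ⟨k, hk⟩ := ih
      refine ⟨k + 1, ?_⟩
      rw [pow_succ, Matrix.mul_apply]
      exact Finset.sum_pos' (fun l _ => mul_nonneg (hpow k _ l) (hB l _))
        ⟨_, Finset.mem_univ _, mul_pos hk (hadj _ _ hbc)⟩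
  choose k hk using hex
  -- The `+ 1` is there because `Finset.range K` stops at `K - 1`.
  refine ⟨(Finset.univ.sup fun p : Fin N × Fin N => k p.1 p.2) + 1, fun i j => ?_⟩
  rw [Matrix.sum_apply]
  refine Finset.sum_pos' (fun l _ => hpow l i j) ⟨k i j, ?_, hk i j⟩
  rw [Finset.mem_range, Nat.lt_succ_iff]
  exact Finset.le_sup (f := fun p : Fin N × Fin N => k p.1 p.2) (Finset.mem_univ (i, j))

theorem mulVec_pos {P : Matrix (Fin N) (Fin N) ℝ} (hP : ∀ i j, 0 < P i j) {x : Fin N → ℝ}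
    (hx : 0 ≤ x) (hx0 : x ≠ 0) (i : Fin N) : 0 < P.mulVec x i := by
  obtain ⟨j, hj⟩ := Function.ne_iff.1 hx0
  exact Finset.sum_pos' (fun l _ => mul_nonneg (hP i l).le (hx l))
    ⟨j, Finset.mem_univ _, mul_pos (hP i j) (lt_of_le_of_ne (hx j) (Ne.symm hj))⟩

/-- **Perron–Frobenius**: an irreducible nonnegative matrix has a positive eigenvector. -/
theorem exists_pos_eigenvector (hN : 1 ≤ N) {B : Matrix (Fin N) (Fin N) ℝ}
    (hB : ∀ i j, 0 ≤ B i j) {G : Digraph (Fin N)} (hG : StronglyConnected G)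
    (hadj : ∀ i j, G.Adj i j → 0 < B i j) :
    ∃ (r : ℝ) (v : Fin N → ℝ), (∀ i, 0 < v i) ∧ B.mulVec v = r • v := by
  obtain ⟨K, hK⟩ := exists_sum_pow_pos hB hG hadj
  set P := ∑ k ∈ Finset.range K, B ^ k with hPdef
  -- `P` has positive entries and commutes with `B`: applying it makes weak inequalities strict and
  -- preserves eigenvectors.
  have hcomm : Commute P B := Commute.sum_left _ _ _ fun k _ => Commute.pow_left (Commute.refl B) k
  let i₀ : Fin N := ⟨0, hN⟩
  have : Nonempty (Fin N) := ⟨i₀⟩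
  -- the Collatz–Wielandt set, over the standard simplex
  set b : ℝ := ∑ i, ∑ j, B i j with hb
  let S : Set (ℝ × (Fin N → ℝ)) :=
    {p | p.1 ∈ Icc 0 b ∧ p.2 ∈ stdSimplex ℝ (Fin N) ∧ ∀ i, p.1 * p.2 i ≤ B.mulVec p.2 i}
  have hScomp : IsCompact S := by
    refine ((isCompact_Icc (a := (0 : ℝ)) (b := b)).prod
      (isCompact_stdSimplex ℝ (Fin N))).of_isClosed_subset ?_ fun p hp => ⟨hp.1, hp.2.1⟩
    refine (isClosed_Icc.preimage continuous_fst).inter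
      (((isClosed_stdSimplex ℝ (Fin N)).preimage continuous_snd).inter ?_)
    have hset : {p : ℝ × (Fin N → ℝ) | ∀ i, p.1 * p.2 i ≤ B.mulVec p.2 i} =
        ⋂ i, {p | p.1 * p.2 i ≤ B.mulVec p.2 i} := by
      ext p
      simp
    change IsClosed {p : ℝ × (Fin N → ℝ) | ∀ i, p.1 * p.2 i ≤ B.mulVec p.2 i}
    rw [hset]
    refine isClosed_iInter fun i => isClosed_le (by fun_prop) ?_
    simp only [Matrix.mulVec, dotProduct]
    fun_prop
  have hsum : ∀ x ∈ stdSimplex ℝ (Fin N), ∀ i, x i ≤ 1 := fun x hx i => by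
    rw [← hx.2]
    exact Finset.single_le_sum (fun j _ => hx.1 j) (Finset.mem_univ i)
  have hSne : S.Nonempty := by
    refine ⟨(0, Pi.single i₀ 1), ⟨le_rfl, ?_⟩, single_mem_stdSimplex ℝ i₀, fun i => ?_⟩
    · exact Finset.sum_nonneg fun i _ => Finset.sum_nonneg fun j _ => hB i j
    · simpa using hB i i₀
  obtain ⟨⟨r, x⟩, ⟨hr, hx, hrx⟩, hmax⟩ := hScomp.exists_isMaxOn hSne continuous_fst.continuousOn
  dsimp only at hr hx hrx
  have hx0 : x ≠ 0 := by
    rintro rfl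
    simpa using hx.2
  have hxnn : 0 ≤ x := hx.1
  -- any normalised competitor is in the set
  have hbound : ∀ (ρ : ℝ) (y : Fin N → ℝ), 0 ≤ ρ → (∀ i, 0 < y i) →
      (∀ i, ρ * y i ≤ B.mulVec y i) → ρ ≤ r := by
    intro ρ y hρ hy hρy
    have hσ : 0 < ∑ i, y i := Finset.sum_pos (fun i _ => hy i) Finset.univ_nonempty
    set σ := ∑ i, y i with hσdef
    have hz : σ⁻¹ • y ∈ stdSimplex ℝ (Fin N) := by
      refine ⟨fun i => mul_nonneg (inv_nonneg.2 hσ.le) (hy i).le, ?_⟩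
      simp only [Pi.smul_apply, smul_eq_mul, ← Finset.mul_sum]
      exact inv_mul_cancel₀ hσ.ne'
    have hz2 : ∀ i, ρ * (σ⁻¹ • y) i ≤ B.mulVec (σ⁻¹ • y) i := by
      intro i
      rw [Matrix.mulVec_smul, Pi.smul_apply, Pi.smul_apply, smul_eq_mul, smul_eq_mul,
        mul_left_comm]
      exact mul_le_mul_of_nonneg_left (hρy i) (inv_nonneg.2 hσ.le)
    refine hmax (a := (ρ, σ⁻¹ • y)) ⟨⟨hρ, ?_⟩, hz, hz2⟩
    -- Summing over the simplex gives ρ on the left; coordinates at most 1 bound the right side by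
    -- the total `b` of the entries.
    have h1 := Finset.sum_le_sum fun i (_ : i ∈ Finset.univ) => hz2 i
    rw [← Finset.mul_sum, hz.2, mul_one] at h1
    refine h1.trans (Finset.sum_le_sum fun i _ => ?_)
    rw [Matrix.mulVec, dotProduct]
    refine Finset.sum_le_sum fun j _ => ?_
    exact mul_le_of_le_one_right (hB i j) (hsum _ hz j)
  have heig : B.mulVec x = r • x := by
    -- If Bx - rx ≥ 0 is nonzero, applying `P` makes it positive everywhere, so `Px` admits a value
    -- larger than the maximum `r`: its least ratio (BPx)_i / (Px)_i.
    by_contra hne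
    have hd0 : B.mulVec x - r • x ≠ 0 := sub_ne_zero.2 hne
    have hdnn : 0 ≤ B.mulVec x - r • x := fun i => by simpa using hrx i
    have hy := mulVec_pos hK hxnn hx0
    have hgap := mulVec_pos hK hdnn hd0
    have hgap' : ∀ i, r * P.mulVec x i < B.mulVec (P.mulVec x) i := by
      intro i
      have := hgap i
      rw [Matrix.mulVec_sub, Matrix.mulVec_mulVec, hcomm.eq, ← Matrix.mulVec_mulVec,
        Matrix.mulVec_smul] at this
      simpa using this
    obtain ⟨i₁, -, hi₁⟩ := Finset.exists_min_image Finset.univ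
      (fun i => B.mulVec (P.mulVec x) i / P.mulVec x i) Finset.univ_nonempty
    have hlt : r < B.mulVec (P.mulVec x) i₁ / P.mulVec x i₁ := (lt_div_iff₀ (hy i₁)).2 (hgap' i₁)
    exact absurd (hbound _ _ (hr.1.trans hlt.le) hy fun i =>
      (le_div_iff₀ (hy i)).1 (hi₁ i (Finset.mem_univ i))) (not_le.2 hlt)
  -- `x` is only known to be nonnegative; `Px` is a positive eigenvector for the same `r`.
  refine ⟨r, P.mulVec x, mulVec_pos hK hxnn hx0, ?_⟩
  rw [Matrix.mulVec_mulVec, ← hcomm.eq, ← Matrix.mulVec_mulVec, heig, Matrix.mulVec_smul]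

theorem le_maxRe {A : Matrix (Fin N) (Fin N) ℝ} {μ : ℝ} {v : Fin N → ℝ} (hv : v ≠ 0)
    (h : A.mulVec v = μ • v) : μ ≤ maxRe A := by
  refine le_csSup ((Module.End.finite_hasEigenvalue _).image _).bddAbove ⟨(μ : ℂ), ?_, by simp⟩
  refine Module.End.hasEigenvalue_of_hasEigenvector (x := fun i => (v i : ℂ)) ⟨?_, ?_⟩
  · rw [Module.End.mem_eigenspace_iff, Matrix.toLin'_apply]
    ext i
    have := congrFun h i
    simp only [Matrix.mulVec, dotProduct, Pi.smul_apply, smul_eq_mul, Matrix.map_apply] at this ⊢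
    exact_mod_cast this
  · intro h0
    apply hv
    ext i
    simpa using congrFun h0 i

/-- If the linearization has no eigenvalue of positive real part, then it has a positive
subsolution. -/
theorem IsSpreadingRate.exists_pos_subsolution (hN : 1 ≤ N) {G : Digraph (Fin N)}
    {f : Fin N → (Fin N → ℝ) → ℝ} (h : IsSpreadingRate G f) (hG : StronglyConnected G)
    {δ : Fin N → ℝ} (hδ : ∀ i, 0 < δ i)
    (hs : maxRe (jacobian f - Matrix.diagonal δ) ≤ 0) :
    ∃ v : Fin N → ℝ, (∀ i, 0 < v i) ∧ ∀ i, ∑ j, jacobian f i j * v j ≤ δ i * v i := by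
  -- Any `c` above every `δ i` would do: adding `c` times the identity to J - diag δ makes it
  -- nonnegative, keeps the eigenvectors and shifts the eigenvalues by `c`.
  set c := ∑ i, δ i
  have hc : ∀ i, δ i ≤ c := fun i =>
    Finset.single_le_sum (fun j _ => (hδ j).le) (Finset.mem_univ i)
  have hle : ∀ i j, jacobian f i j ≤ (jacobian f + Matrix.diagonal fun i => c - δ i) i j := by
    intro i j
    rw [Matrix.add_apply, Matrix.diagonal_apply]
    split_ifs
    · linarith [hc i]
    · simp
  obtain ⟨r, v, hv, hrv⟩ := exists_pos_eigenvector hN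
    (fun i j => (h.jacobian_nonneg i j).trans (hle i j)) hG
    (fun i j hij => (h.jacobian_pos hij).trans_le (hle i j))
  have heig : (jacobian f - Matrix.diagonal δ).mulVec v = (r - c) • v := by
    ext i
    have := congrFun hrv i
    simp only [Matrix.add_mulVec, Matrix.sub_mulVec, Pi.add_apply, Pi.sub_apply,
      Matrix.mulVec_diagonal, Pi.smul_apply, smul_eq_mul] at this ⊢
    linarith
  have hv0 : v ≠ 0 := fun h0 => (hv ⟨0, hN⟩).ne' (congrFun h0 _)
  have hr := (le_maxRe hv0 heig).trans hs
  refine ⟨v, hv, fun i => ?_⟩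
  have := congrFun heig i
  simp only [Matrix.sub_mulVec, Pi.sub_apply, Matrix.mulVec_diagonal, Pi.smul_apply,
    smul_eq_mul] at this
  have h3 := mul_nonpos_of_nonpos_of_nonneg hr (hv i).le
  change (jacobian f).mulVec v i ≤ _
  linarith

/-! ### Comparison principles and decay -/

/-- The line c + εt is a strict barrier for every ε > 0; then ε → 0. The sign is required wherever u
≥ c, not only at u = c. -/
theorem le_of_deriv_nonpos_above {u u' : ℝ → ℝ} {c : ℝ}
    (hd : ∀ t, 0 ≤ t → HasDerivWithinAt u (u' t) (Ici 0) t) (h0 : u 0 ≤ c)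
    (h : ∀ t, 0 ≤ t → c ≤ u t → u' t ≤ 0) {t : ℝ} (ht : 0 ≤ t) : u t ≤ c := by
  have key : ∀ ε > 0, u t ≤ c + ε * t := by
    intro ε hε
    refine image_le_of_deriv_right_lt_deriv_boundary' (f := u) (f' := u') (a := 0) (b := t)
      (B := fun s => c + ε * s) (B' := fun _ => ε)
      (fun s hs => (hd s hs.1).continuousWithinAt.mono Icc_subset_Ici_self)
      (fun s hs => (hd s hs.1).mono (Ici_subset_Ici.2 hs.1)) (by simpa using h0) (by fun_prop)
      (fun s _ => ?_) (fun s hs hsu => ?_) (right_mem_Icc.2 ht)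
    · simpa using (((hasDerivAt_id s).const_mul ε).const_add c).hasDerivWithinAt
    · refine (h s hs.1 ?_).trans_lt hε
      have := mul_nonneg hε.le hs.1
      linarith
  have hlim : Tendsto (fun ε : ℝ => c + ε * t) (𝓝[>] 0) (𝓝 c) := by
    have : Continuous fun ε : ℝ => c + ε * t := by fun_prop
    simpa using (this.tendsto 0).mono_left nhdsWithin_le_nhds
  exact ge_of_tendsto hlim (eventually_nhdsWithin_of_forall fun ε hε => key ε hε)

/-- A finite family of functions that starts negative stays negative, if none of them can be the
first to reach zero. -/
theorem forall_neg_of_deriv_neg {ι : Type*} [Finite ι] {u u' : ι → ℝ → ℝ}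
    (hd : ∀ i t, 0 ≤ t → HasDerivWithinAt (u i) (u' i t) (Ici 0) t) (h0 : ∀ i, u i 0 < 0)
    (h : ∀ i t, 0 ≤ t → (∀ j, u j t ≤ 0) → u i t = 0 → u' i t < 0) :
    ∀ i t, 0 ≤ t → u i t < 0 := by
  by_contra! hcon
  obtain ⟨i₀, t₀, ht₀, hi₀⟩ := hcon
  have hcont : ∀ i, ContinuousOn (u i) (Ici 0) := fun i t ht => (hd i t ht).continuousWithinAt
  -- The times at which some member is nonnegative; the infimum τ is attained. The member vanishing
  -- at τ was negative before, so its left slopes are nonnegative, against `h`.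
  set S : Set ℝ := ⋃ i, Ici 0 ∩ u i ⁻¹' Ici 0 with hS
  have hclosed : IsClosed S := isClosed_iUnion_of_finite fun i =>
    (hcont i).preimage_isClosed_of_isClosed isClosed_Ici isClosed_Ici
  have hbdd : BddBelow S := ⟨0, fun t ht => by
    obtain ⟨i, hi⟩ := mem_iUnion.1 ht
    exact hi.1⟩
  have hmem : sInf S ∈ S := hclosed.csInf_mem ⟨t₀, mem_iUnion.2 ⟨i₀, ht₀, hi₀⟩⟩ hbdd
  set τ := sInf S
  obtain ⟨i, hτ, hi⟩ := mem_iUnion.1 hmem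
  simp only [mem_Ici, mem_preimage] at hτ hi
  have hτpos : 0 < τ := lt_of_le_of_ne hτ fun heq => by
    rw [← heq] at hi
    exact absurd hi (not_le.2 (h0 i))
  have hbefore : ∀ j, ∀ s ∈ Ico 0 τ, u j s < 0 := by
    intro j s hs
    by_contra! hneg
    exact absurd (csInf_le hbdd (mem_iUnion.2 ⟨j, hs.1, hneg⟩)) (not_le.2 hs.2)
  have hev : ∀ᶠ s in 𝓝[<] τ, s ∈ Ico 0 τ := by
    filter_upwards [Ioo_mem_nhdsLT hτpos] with s hs using ⟨hs.1.le, hs.2⟩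
  have hderiv : ∀ j, HasDerivAt (u j) (u' j τ) τ := fun j =>
    (hd j τ hτ).hasDerivAt (Ici_mem_nhds hτpos)
  have hle : ∀ j, u j τ ≤ 0 := fun j =>
    le_of_tendsto ((hderiv j).continuousAt.tendsto.mono_left nhdsWithin_le_nhds)
      (hev.mono fun s hs => (hbefore j s hs).le)
  have hzero : u i τ = 0 := le_antisymm (hle i) hi
  have hslope := (hasDerivWithinAt_iff_tendsto_slope' (s := Iio τ) (by simp)).1
    (hderiv i).hasDerivWithinAt
  refine absurd (h i τ hτ hle hzero) (not_lt.2 (ge_of_tendsto hslope (hev.mono fun s hs => ?_)))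
  rw [slope_def_field, hzero, sub_zero]
  exact div_nonneg_of_nonpos (hbefore i s hs).le (sub_nonpos.2 hs.2.le)

theorem exists_pos_forall_lt {w : Fin N → ℝ} (hw : ∀ i, 0 < w i) : ∃ c > 0, ∀ i, c < w i := by
  have h : ∀ᶠ c in 𝓝[>] (0 : ℝ), ∀ i, c < w i :=
    eventually_all.2 fun i => nhdsWithin_le_nhds (Iio_mem_nhds (hw i))
  obtain ⟨c, hc, hpos⟩ := (h.and self_mem_nhdsWithin).exists
  exact ⟨c, hpos, hc⟩

/-- A message whose probabilities are dominated by the one-message model dies out, if the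
linearization of that model at the origin has no eigenvalue of positive real part. -/
theorem IsSpreadingRate.tendsto_zero (hN : 1 ≤ N) {G : Digraph (Fin N)}
    {f : Fin N → (Fin N → ℝ) → ℝ} (h : IsSpreadingRate G f) (hG : StronglyConnected G)
    {δ : Fin N → ℝ} (hδ : ∀ i, 0 < δ i) (hs : maxRe (jacobian f - Matrix.diagonal δ) ≤ 0)
    {p p' : ℝ → Fin N → ℝ} (hp : ∀ t, 0 ≤ t → p t ∈ cube N)
    (hd : ∀ i t, 0 ≤ t → HasDerivWithinAt (fun s => p s i) (p' t i) (Ici 0) t)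
    (hle : ∀ i t, 0 ≤ t → p' t i ≤ (1 - p t i) * f i (p t) - δ i * p t i) :
    Tendsto p atTop (𝓝 0) := by
  obtain ⟨v, hv, hvsub⟩ := h.exists_pos_subsolution hN hG hδ hs
  -- c < δ_i v_i makes the barrier decay more slowly than the quadratic loss; a < v_i makes it
  -- exceed 1 at time 0.
  obtain ⟨c, hc, hcv⟩ := exists_pos_forall_lt fun i => mul_pos (hδ i) (hv i)
  obtain ⟨a, ha, hav⟩ := exists_pos_forall_lt hv
  set φ : ℝ → ℝ := fun t => (a + c * t)⁻¹ with hφ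
  have hpos : ∀ t, 0 ≤ t → 0 < a + c * t := fun t ht => by positivity
  have hφd : ∀ t, 0 ≤ t → HasDerivAt φ (-(c * φ t ^ 2)) t := by
    intro t ht
    have h1 : HasDerivAt (fun s => a + c * s) c t := by
      simpa using ((hasDerivAt_id t).const_mul c).const_add a
    refine (h1.inv (hpos t ht).ne').congr_deriv ?_
    simp only [hφ]
    field_simp
  have hbound : ∀ i t, 0 ≤ t → p t i - φ t * v i < 0 := by
    refine forall_neg_of_deriv_neg (u' := fun i t => p' t i - -(c * φ t ^ 2) * v i)
      (fun i t ht => (hd i t ht).sub ((hφd t ht).mul_const (v i)).hasDerivWithinAt) ?_ ?_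
    · intro i
      have h1 := (mem_cube_iff.1 (hp 0 le_rfl) i).2
      have h2 : 1 < a⁻¹ * v i := by
        rw [inv_mul_eq_div, one_lt_div ha]
        exact hav i
      simp only [hφ, mul_zero, add_zero]
      linarith
    · intro i t ht hall hi
      have hφt : 0 < φ t := inv_pos.2 (hpos t ht)
      have hpi : p t i = φ t * v i := sub_eq_zero.1 hi
      have hf : f i (p t) ≤ δ i * p t i := by
        calc f i (p t) ≤ ∑ j, jacobian f i j * p t j := h.le_jacobian_mulVec i (hp t ht)
          _ ≤ ∑ j, jacobian f i j * (φ t * v j) := Finset.sum_le_sum fun j _ =>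
              mul_le_mul_of_nonneg_left (sub_nonpos.1 (hall j)) (h.jacobian_nonneg i j)
          _ = φ t * ∑ j, jacobian f i j * v j := by
              rw [Finset.mul_sum]
              exact Finset.sum_congr rfl fun j _ => by ring
          _ ≤ φ t * (δ i * v i) := mul_le_mul_of_nonneg_left (hvsub i) hφt.le
          _ = δ i * p t i := by rw [hpi]; ring
      have h1 := hle i t ht
      have h2 := mul_le_mul_of_nonneg_left hf
        (sub_nonneg.2 (mem_cube_iff.1 (hp t ht) i).2)
      have h3 : 0 < φ t ^ 2 * v i * (δ i * v i - c) :=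
        mul_pos (mul_pos (pow_pos hφt 2) (hv i)) (sub_pos.2 (hcv i))
      -- At contact, p_i' ≤ -δ_i p_i² = -δ_i v_i² φ², which is strictly below -c v_i φ² = φ' v_i.
      have h4 : p' t i ≤ -(δ i * p t i ^ 2) := by linarith
      rw [hpi] at h4
      linarith
  have hφ0 : Tendsto φ atTop (𝓝 0) :=
    tendsto_inv_atTop_zero.comp
      (tendsto_atTop_add_const_left _ a (tendsto_id.const_mul_atTop hc))
  refine tendsto_pi_nhds.2 fun i => ?_
  have hφv : Tendsto (fun t => φ t * v i) atTop (𝓝 0) := by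
    simpa using hφ0.mul_const (v i)
  refine tendsto_of_tendsto_of_tendsto_of_le_of_le' tendsto_const_nhds hφv ?_ ?_
  · filter_upwards [eventually_ge_atTop 0] with t ht using (mem_cube_iff.1 (hp t ht) i).1
  · filter_upwards [eventually_ge_atTop 0] with t ht using (sub_neg.1 (hbound i t ht)).le

/-! ### Global existence and clamping -/

/-- Global existence for a bounded Lipschitz vector field. -/
theorem exists_isIntegralCurveOn_Ici {E : Type*} [NormedAddCommGroup E] [NormedSpace ℝ E]
    [CompleteSpace E] {F : E → E} {K L : NNReal} (hF : LipschitzWith K F) (hL : ∀ x, ‖F x‖ ≤ L)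
    (x : E) : ∃ γ : ℝ → E, γ 0 = x ∧ IsIntegralCurveOn γ (fun _ => F) (Ici 0) := by
  have hloc : ∀ n : ℕ, ∃ α : ℝ → E, α 0 = x ∧
      ∀ t ∈ Ioo (-(n + 1) : ℝ) (n + 1), HasDerivAt α (F (α t)) t := by
    intro n
    have hn : (0 : ℝ) < n + 1 := by positivity
    -- Speed at most `L` for time `n + 1` stays in the ball of radius `L * (n + 1)`; the `0` allows
    -- only the initial point `x`.
    have hPL : IsPicardLindelof (fun _ => F) (tmin := -(n + 1)) (tmax := n + 1)
        ⟨0, by simp only [mem_Icc]; constructor <;> linarith⟩ x (L * (n + 1)) 0 L K :=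
      { lipschitzOnWith := fun _ _ => hF.lipschitzOnWith
        continuousOn := fun _ _ => continuousOn_const
        norm_le := fun _ _ y _ => hL y
        mul_max_le := by simp }
    obtain ⟨α, h0, hα⟩ := hPL.exists_eq_forall_mem_Icc_hasDerivWithinAt₀
    exact ⟨α, h0, fun t ht => (hα t (Ioo_subset_Icc_self ht)).hasDerivAt (Icc_mem_nhds ht.1 ht.2)⟩
  choose α hα0 hα using hloc
  have heq : ∀ m n : ℕ, m ≤ n → EqOn (α m) (α n) (Ioo (-(m + 1) : ℝ) (m + 1)) := by
    intro m n hmn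
    have hm : (0 : ℝ) < m + 1 := by positivity
    have hmn' : (m : ℝ) ≤ n := by exact_mod_cast hmn
    refine ODE_solution_unique_of_mem_Ioo (v := fun _ => F) (s := fun _ => univ) (t₀ := 0)
      (fun _ _ => hF.lipschitzOnWith) ⟨by linarith, hm⟩ (fun t ht => ⟨hα m t ht, trivial⟩)
      (fun t ht => ⟨hα n t ⟨by linarith [ht.1], by linarith [ht.2]⟩, trivial⟩)
      ((hα0 m).trans (hα0 n).symm)
  have hfloor : ∀ (n : ℕ), ∀ t ∈ Ico (0 : ℝ) (n + 1), α ⌊t⌋₊ t = α n t := by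
    intro n t ht
    have hlt : ⌊t⌋₊ < n + 1 := (Nat.floor_lt ht.1).2 (by exact_mod_cast ht.2)
    refine heq _ _ (Nat.lt_succ_iff.1 hlt) ⟨?_, Nat.lt_floor_add_one t⟩
    have : (0 : ℝ) < ⌊t⌋₊ + 1 := by positivity
    linarith [ht.1]
  -- Gluing: by uniqueness this agrees with the single curve `α ⌊t⌋₊` on [0, ⌊t⌋₊ + 1), a
  -- neighbourhood of `t` in [0, ∞).
  refine ⟨fun t => α ⌊t⌋₊ t, by simp [hα0], fun t ht => ?_⟩
  have ht' : (0 : ℝ) ≤ t := ht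
  have hlt := Nat.lt_floor_add_one t
  have hd := (hα ⌊t⌋₊ t ⟨by linarith, hlt⟩).hasDerivWithinAt (s := Ici 0)
  refine hd.congr_of_eventuallyEq ?_ rfl
  filter_upwards [self_mem_nhdsWithin, nhdsWithin_le_nhds (Iio_mem_nhds hlt)] with s hs hs'
  exact hfloor _ s ⟨hs, hs'⟩

theorem hasDerivWithinAt_fst_apply {γ : ℝ → State N} {y : State N} {s : Set ℝ} {t : ℝ}
    (h : HasDerivWithinAt γ y s t) (i : Fin N) :
    HasDerivWithinAt (fun t => (γ t).1 i) (y.1 i) s t :=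
  hasDerivWithinAt_pi.1 h.fst i

theorem hasDerivWithinAt_snd_apply {γ : ℝ → State N} {y : State N} {s : Set ℝ} {t : ℝ}
    (h : HasDerivWithinAt γ y s t) (i : Fin N) :
    HasDerivWithinAt (fun t => (γ t).2 i) (y.2 i) s t :=
  hasDerivWithinAt_pi.1 h.snd i

/-- The projection of the line onto `[0, 1]`. -/
noncomputable def clampReal (a : ℝ) : ℝ := max 0 (min 1 a)

theorem clampReal_mem (a : ℝ) : clampReal a ∈ Icc (0 : ℝ) 1 :=
  ⟨le_max_left _ _, max_le zero_le_one (min_le_left _ _)⟩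

theorem clampReal_of_mem {a : ℝ} (h : a ∈ Icc (0 : ℝ) 1) : clampReal a = a := by
  rw [clampReal, min_eq_right h.2, max_eq_right h.1]

theorem clampReal_of_nonpos {a : ℝ} (h : a ≤ 0) : clampReal a = 0 :=
  max_eq_left ((min_le_right _ _).trans h)

theorem clampReal_of_one_le {a : ℝ} (h : 1 ≤ a) : clampReal a = 1 := by
  rw [clampReal, min_eq_left h, max_eq_right zero_le_one]

theorem dist_clampReal_le (a b : ℝ) : dist (clampReal a) (clampReal b) ≤ dist a b := by
  simpa [clampReal] using ((LipschitzWith.id.const_min (1 : ℝ)).const_max (0 : ℝ)).dist_le_mul a b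

/-- The projection of the state space onto `[0, 1]^N × [0, 1]^N`. -/
noncomputable def clamp (x : State N) : State N :=
  (fun i => clampReal (x.1 i), fun i => clampReal (x.2 i))

theorem clamp_mem (x : State N) : clamp x ∈ cube N ×ˢ cube N :=
  ⟨mem_cube_iff.2 fun _ => clampReal_mem _, mem_cube_iff.2 fun _ => clampReal_mem _⟩

theorem clamp_of_mem {x : State N} (h : x ∈ cube N ×ˢ cube N) : clamp x = x :=
  Prod.ext (funext fun i => clampReal_of_mem (mem_cube_iff.1 h.1 i))
    (funext fun i => clampReal_of_mem (mem_cube_iff.1 h.2 i))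

theorem lipschitzWith_clamp : LipschitzWith 1 (clamp (N := N)) := by
  refine LipschitzWith.of_dist_le_mul fun x y => ?_
  rw [NNReal.coe_one, one_mul, Prod.dist_eq, Prod.dist_eq]
  refine max_le_max ?_ ?_
  · exact (dist_pi_le_iff dist_nonneg).2 fun i =>
      (dist_clampReal_le _ _).trans (dist_le_pi_dist x.1 y.1 i)
  · exact (dist_pi_le_iff dist_nonneg).2 fun i =>
      (dist_clampReal_le _ _).trans (dist_le_pi_dist x.2 y.2 i)

/-! ### The URTU field: existence, invariance, extinction -/

namespace Model

variable (M : Model N)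

theorem contDiffOn_field : ContDiffOn ℝ 1 M.field (cube N ×ˢ cube N) := by
  have h1 : ∀ {G : Digraph (Fin N)} {f : Fin N → (Fin N → ℝ) → ℝ}, IsSpreadingRate G f →
      ∀ i, ContDiffOn ℝ 1 (fun x : State N => f i x.1) (cube N ×ˢ cube N) := fun h i =>
    ((h.smooth i).of_le (by norm_num)).comp contDiff_fst.contDiffOn fun x hx => hx.1
  have h2 : ∀ {G : Digraph (Fin N)} {f : Fin N → (Fin N → ℝ) → ℝ}, IsSpreadingRate G f →
      ∀ i, ContDiffOn ℝ 1 (fun x : State N => f i x.2) (cube N ×ˢ cube N) := fun h i =>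
    ((h.smooth i).of_le (by norm_num)).comp contDiff_snd.contDiffOn fun x hx => hx.2
  have e1 : ∀ i, ContDiffOn ℝ 1 (fun x : State N => x.1 i) (cube N ×ˢ cube N) := fun i => by
    fun_prop
  have e2 : ∀ i, ContDiffOn ℝ 1 (fun x : State N => x.2 i) (cube N ×ˢ cube N) := fun i => by
    fun_prop
  refine ContDiffOn.prodMk (contDiffOn_pi.2 fun i => ?_) (contDiffOn_pi.2 fun i => ?_)
  · exact ((((contDiffOn_const.sub (e1 i)).sub (e2 i)).mul (h1 M.rate_fU i)).sub
      (contDiffOn_const.mul (e1 i))).add ((e2 i).mul (h1 M.rate_fT i)) |>.sub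
      ((e1 i).mul (h2 M.rate_gR i))
  · exact ((((contDiffOn_const.sub (e1 i)).sub (e2 i)).mul (h2 M.rate_gU i)).sub
      (contDiffOn_const.mul (e2 i))).add ((e1 i).mul (h2 M.rate_gR i)) |>.sub
      ((e2 i).mul (h1 M.rate_fT i))

theorem exists_lipschitzOnWith_field : ∃ K, LipschitzOnWith K M.field (cube N ×ˢ cube N) := by
  refine LocallyLipschitzOn.exists_lipschitzOnWith_of_compact (isCompact_cube.prod isCompact_cube)
    fun x hx => ?_
  exact (M.contDiffOn_field x hx).exists_lipschitzOnWith (convex_cube.prod convex_cube)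

/-- On the boundary of `[0, 1]^N × [0, 1]^N` the vector field does not point outwards. -/
theorem field_fst_nonneg {x : State N} (hx : x ∈ cube N ×ˢ cube N) {i : Fin N}
    (hi : x.1 i = 0) : 0 ≤ (M.field x).1 i := by
  have h2 := mem_cube_iff.1 hx.2 i
  have hU := M.rate_fU.nonneg i hx.1
  have hT := M.rate_fT.nonneg i hx.1
  simp only [field, hi]
  have := mul_nonneg (sub_nonneg.2 h2.2) hU
  have := mul_nonneg h2.1 hT
  linarith

/-- Here 1 - R_i - T_i = -T_i may be negative; the gain T_i f_i^T is absorbed by T_i f_i^U. -/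
theorem field_fst_nonpos {x : State N} (hx : x ∈ cube N ×ˢ cube N) {i : Fin N}
    (hi : x.1 i = 1) : (M.field x).1 i ≤ 0 := by
  have h2 := mem_cube_iff.1 hx.2 i
  have hR := M.rate_gR.nonneg i hx.2
  have := mul_le_mul_of_nonneg_left (M.ordering_f i x.1 hx.1) h2.1
  have := M.δR_pos i
  simp only [field, hi]
  linarith

theorem field_snd_nonneg {x : State N} (hx : x ∈ cube N ×ˢ cube N) {i : Fin N}
    (hi : x.2 i = 0) : 0 ≤ (M.field x).2 i := by
  have h1 := mem_cube_iff.1 hx.1 i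
  have hU := M.rate_gU.nonneg i hx.2
  have hR := M.rate_gR.nonneg i hx.2
  simp only [field, hi]
  have := mul_nonneg (sub_nonneg.2 h1.2) hU
  have := mul_nonneg h1.1 hR
  linarith

theorem field_snd_nonpos {x : State N} (hx : x ∈ cube N ×ˢ cube N) {i : Fin N}
    (hi : x.2 i = 1) : (M.field x).2 i ≤ 0 := by
  have h1 := mem_cube_iff.1 hx.1 i
  have hT := M.rate_fT.nonneg i hx.1
  have := mul_le_mul_of_nonneg_left (M.ordering_g i x.2 hx.2) h1.1
  have := M.δT_pos i
  simp only [field, hi]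
  linarith

/-- Follow `M.field ∘ clamp`, which is bounded and Lipschitz. A coordinate beyond a face is clamped
to that face, where the field does not point outwards; so the curve stays in the cube, where `clamp`
is the identity. -/
theorem exists_isSolution {x : State N} (hx : x ∈ cube N ×ˢ cube N) :
    ∃ γ, M.IsSolution γ ∧ γ 0 = x := by
  obtain ⟨K, hK⟩ := M.exists_lipschitzOnWith_field
  obtain ⟨L, hL⟩ := (isCompact_cube.prod isCompact_cube).exists_bound_of_continuousOn
    M.contDiffOn_field.continuousOn
  have hlip : LipschitzWith (K * 1) (M.field ∘ clamp) := by
    rw [← lipschitzOnWith_univ]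
    exact hK.comp lipschitzWith_clamp.lipschitzOnWith fun y _ => clamp_mem y
  obtain ⟨γ, h0, hγ⟩ := exists_isIntegralCurveOn_Ici hlip
    (fun y => (hL _ (clamp_mem y)).trans (Real.le_coe_toNNReal L)) x
  have hmem : ∀ t, 0 ≤ t → γ t ∈ cube N ×ˢ cube N := by
    intro t ht
    have hd1 := fun i t ht => hasDerivWithinAt_fst_apply (hγ t ht) i
    have hd2 := fun i t ht => hasDerivWithinAt_snd_apply (hγ t ht) i
    have hx1 := mem_cube_iff.1 hx.1
    have hx2 := mem_cube_iff.1 hx.2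
    refine ⟨mem_cube_iff.2 fun i => ⟨?_, ?_⟩, mem_cube_iff.2 fun i => ⟨?_, ?_⟩⟩
    · refine neg_nonpos.1 (le_of_deriv_nonpos_above (fun t ht => (hd1 i t ht).neg)
        (by simpa [h0] using (hx1 i).1) (fun s _ hs => ?_) ht)
      exact neg_nonpos.2 (M.field_fst_nonneg (clamp_mem _)
        (clampReal_of_nonpos (neg_nonneg.1 hs)))
    · exact le_of_deriv_nonpos_above (hd1 i) (by simpa [h0] using (hx1 i).2)
        (fun s _ hs => M.field_fst_nonpos (clamp_mem _) (clampReal_of_one_le hs)) ht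
    · refine neg_nonpos.1 (le_of_deriv_nonpos_above (fun t ht => (hd2 i t ht).neg)
        (by simpa [h0] using (hx2 i).1) (fun s _ hs => ?_) ht)
      exact neg_nonpos.2 (M.field_snd_nonneg (clamp_mem _)
        (clampReal_of_nonpos (neg_nonneg.1 hs)))
    · exact le_of_deriv_nonpos_above (hd2 i) (by simpa [h0] using (hx2 i).2)
        (fun s _ hs => M.field_snd_nonpos (clamp_mem _) (clampReal_of_one_le hs)) ht
  refine ⟨γ, ⟨hmem, fun t ht => ?_⟩, h0⟩
  have : HasDerivWithinAt γ (M.field (clamp (γ t))) (Ici 0) t := hγ t ht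
  rwa [clamp_of_mem (hmem t ht)] at this

theorem isEquilibrium_zero : M.IsEquilibrium 0 := by
  refine Prod.ext (funext fun i => ?_) (funext fun i => ?_) <;>
    simp [field, M.rate_fU.nullity i, M.rate_gU.nullity i]

/-- Solutions lie in the cube by definition, so only R_i + T_i ≤ 1 is at stake. In the derivative of
the sum the conversion terms cancel, and above level 1 all the rest is nonpositive. -/
theorem positivelyInvariant_Ω : M.PositivelyInvariant (Ω N) := by
  intro γ hγ h0 t ht i
  have hmem := hγ.mem_domain t ht
  refine ⟨(mem_cube_iff.1 hmem.1 i).1, (mem_cube_iff.1 hmem.2 i).1, ?_⟩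
  refine le_of_deriv_nonpos_above (u := fun s => (γ s).1 i + (γ s).2 i)
    (fun s hs => (hasDerivWithinAt_fst_apply (hγ.ode s hs) i).add
      (hasDerivWithinAt_snd_apply (hγ.ode s hs) i)) (h0 i).2.2 (fun s hs hsum => ?_) ht
  have hs' := hγ.mem_domain s hs
  have hf := M.rate_fU.nonneg i hs'.1
  have hg := M.rate_gU.nonneg i hs'.2
  have := mul_nonneg (M.δR_pos i).le (mem_cube_iff.1 hs'.1 i).1
  have := mul_nonneg (M.δT_pos i).le (mem_cube_iff.1 hs'.2 i).1
  have := mul_nonneg (sub_nonneg.2 hsum) (add_nonneg hf hg)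
  simp only [field]
  linarith

theorem tendsto_zero (hN : 1 ≤ N) (h₁ : maxRe M.Q₁ ≤ 0) (h₂ : maxRe M.Q₂ ≤ 0)
    {γ : ℝ → State N} (hγ : M.IsSolution γ) : Tendsto γ atTop (𝓝 0) := by
  refine Tendsto.prodMk_nhds (mx := fun t => (γ t).1) (my := fun t => (γ t).2) ?_ ?_
  · refine M.rate_fU.tendsto_zero hN M.connR M.δR_pos h₁ (fun t ht => (hγ.mem_domain t ht).1)
      (fun i t ht => hasDerivWithinAt_fst_apply (hγ.ode t ht) i) fun i t ht => ?_
    obtain ⟨hR, hT⟩ := hγ.mem_domain t ht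
    have := mul_le_mul_of_nonneg_left (M.ordering_f i _ hR) (mem_cube_iff.1 hT i).1
    have := mul_nonneg (mem_cube_iff.1 hR i).1 (M.rate_gR.nonneg i hT)
    simp only [field]
    linarith
  · refine M.rate_gU.tendsto_zero hN M.connT M.δT_pos h₂ (fun t ht => (hγ.mem_domain t ht).2)
      (fun i t ht => hasDerivWithinAt_snd_apply (hγ.ode t ht) i) fun i t ht => ?_
    obtain ⟨hR, hT⟩ := hγ.mem_domain t ht
    have := mul_le_mul_of_nonneg_left (M.ordering_g i _ hT) (mem_cube_iff.1 hR i).1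
    have := mul_nonneg (mem_cube_iff.1 hT i).1 (M.rate_fT.nonneg i hR)
    simp only [field]
    linarith

end Model

theorem Ω_subset : Ω N ⊆ cube N ×ˢ cube N := fun x hx =>
  ⟨mem_cube_iff.2 fun i => ⟨(hx i).1, by linarith [hx i]⟩,
    mem_cube_iff.2 fun i => ⟨(hx i).2.1, by linarith [hx i]⟩⟩

theorem continuous_fraction : Continuous (fraction (N := N)) := by
  unfold fraction
  fun_prop

end URTU

theorem theorem2 {N : ℕ} (hN : 1 ≤ N) (M : URTU.Model N)
    (h₁ : URTU.maxRe M.Q₁ ≤ 0) (h₂ : URTU.maxRe M.Q₂ ≤ 0) :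
    M.IsEquilibrium 0 ∧ M.PositivelyInvariant (URTU.Ω N) ∧ M.Attracts 0 (URTU.Ω N) ∧
      ∀ γ : ℝ → URTU.State N, M.IsSolution γ → γ 0 ∈ URTU.Ω N →
        Tendsto (fun t => URTU.fraction (γ t).1) atTop (𝓝 0) ∧
        Tendsto (fun t => URTU.fraction (γ t).2) atTop (𝓝 0) := by
  refine ⟨M.isEquilibrium_zero, M.positivelyInvariant_Ω,
    ⟨fun x hx => M.exists_isSolution (URTU.Ω_subset hx),
      fun γ hγ _ => M.tendsto_zero hN h₁ h₂ hγ⟩, fun γ hγ _ => ?_⟩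
  have hlim := M.tendsto_zero hN h₁ h₂ hγ
  have h0 : URTU.fraction (0 : Fin N → ℝ) = 0 := by simp [URTU.fraction]
  have hfr := URTU.continuous_fraction.tendsto (0 : Fin N → ℝ)
  rw [h0] at hfr
  exact ⟨hfr.comp ((continuous_fst.tendsto _).comp hlim),
    hfr.comp ((continuous_snd.tendsto _).comp hlim)⟩
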